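/- Let $(M,g)$ be a four-dimensional spacetime, with $g$ a metric of class $C^2$ and signature $(-,+,+,+)$, and let $W$ be its Weyl tensor, $*W_{\alpha\beta\gamma\delta}=\frac12\,\eta_{\alpha\beta}{}^{\rho\sigma}W_{\rho\sigma\gamma\delta}$ its dual ($\eta$ being the metric volume element), and $$T_{\alpha\mu\beta\nu}=\tfrac14\left(W_\alpha{}^\rho{}_\beta{}^\sigma W_{\mu\rho\nu\sigma}+{*W}_\alpha{}^\rho{}_\beta{}^\sigma\,{*W}_{\mu\rho\nu\sigma}\right)$$ the Bel–Robinson tensor. For an observer $u$ at a point (a vector with $g(u,u)=-1$) put $$\tau=T(u,u,u,u),\quad q_\perp=-T(u,u,u)_\perp,\quad t_\perp=T(u,u)_\perp,\quad Q_\perp=-T(u)_\perp,\quad T_\perp,$$ where $A_\perp$ is the projection of all the indices of $A$ by $\gamma=u\otimes u+g$, and $|A|=\sqrt{(A,A)}$, where $(A,A)$ is the full contraction of $A$ with itself by means of $g$. Then, at every point and for every observer $u$, $$|Q_\perp|^2-|q_\perp|^2=3\left(\tau^2-|t_\perp|^2\right)\ge 0,\qquad 3\tau-|T_\perp|\ge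 0 .$$ More generally, the same constraints hold, for the tensor $T$ constructed as above, when $W$ is any tensor on a four-dimensional Lorentzian vector space which has the algebraic symmetries of a Weyl tensor ($W_{\alpha\beta\gamma\delta}=-W_{\beta\alpha\gamma\delta}=-W_{\alpha\beta\delta\gamma}=W_{\gamma\delta\alpha\beta}$, $W_{\alpha\beta\gamma\delta}+W_{\alpha\gamma\delta\beta}+W_{\alpha\delta\beta\gamma}=0$, $g^{\alpha\gamma}W_{\alpha\beta\gamma\delta}=0$). -/

import Mathlib

noncomputable section

namespace BelRobinson

/-- Covariant tensors of rank `k` on a four-dimensional space, given by their components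
`A_{a₀ … a_{k-1}}` in a basis. -/
abbrev Tensor (k : ℕ) : Type := (Fin k → Fin 4) → ℝ

/-- The symmetric matrix `g` is the Gram matrix of a form of signature `(-,+,+,+)`. -/
def IsLorentzian (g : Matrix (Fin 4) (Fin 4) ℝ) : Prop :=
  g.IsSymm ∧ ∃ P : Matrix (Fin 4) (Fin 4) ℝ,
    IsUnit P.det ∧ P.transpose * g * P = Matrix.diagonal ![-1, 1, 1, 1]

/-- The vector `u` (with contravariant components `u^a`) is an observer: `g(u,u) = -1`. -/
def IsObserver (g : Matrix (Fin 4) (Fin 4) ℝ) (u : Fin 4 → ℝ) : Prop :=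
  ∑ a, ∑ b, g a b * u a * u b = -1

/-- The tensors with all the algebraic symmetries of a Weyl tensor: those of a curvature tensor,
and vanishing trace. -/
structure IsWeylTensor (g : Matrix (Fin 4) (Fin 4) ℝ) (W : Tensor 4) : Prop where
  antisymm_left : ∀ a b c d, W ![a, b, c, d] = -W ![b, a, c, d]
  antisymm_right : ∀ a b c d, W ![a, b, c, d] = -W ![a, b, d, c]
  pair_symm : ∀ a b c d, W ![a, b, c, d] = W ![c, d, a, b]
  cyclic : ∀ a b c d, W ![a, b, c, d] + W ![a, c, d, b] + W ![a, d, b, c] = 0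
  traceless : ∀ b d, ∑ a, ∑ c, g⁻¹ a c * W ![a, b, c, d] = 0

/-- The Levi-Civita symbol. -/
def leviCivita (a : Fin 4 → Fin 4) : ℝ :=
  Matrix.det (Matrix.of fun i j : Fin 4 => if a i = j then (1 : ℝ) else 0)

/-- The metric volume element `η_{abcd}`. -/
def volumeElement (g : Matrix (Fin 4) (Fin 4) ℝ) : Tensor 4 :=
  fun a => Real.sqrt |g.det| * leviCivita a

/-- The dual `(*W)_{abcd} = (1/2) η_{ab}^{rs} W_{rscd}`. -/
def dual (g : Matrix (Fin 4) (Fin 4) ℝ) (W : Tensor 4) : Tensor 4 := fun i =>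
  (1 / 2) * ∑ r, ∑ s, ∑ r', ∑ s',
    volumeElement g ![i 0, i 1, r, s] * g⁻¹ r r' * g⁻¹ s s' * W ![r', s', i 2, i 3]

/-- The Bel-Robinson tensor
`T_{αμβν} = (1/4) (W_α^ρ_β^σ W_{μρνσ} + *W_α^ρ_β^σ *W_{μρνσ})`. -/
def belRobinson (g : Matrix (Fin 4) (Fin 4) ℝ) (W : Tensor 4) : Tensor 4 := fun i =>
  (1 / 4) * ∑ r, ∑ r', ∑ s, ∑ s', g⁻¹ r r' * g⁻¹ s s' *
    (W ![i 0, r', i 2, s'] * W ![i 1, r, i 3, s]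
      + dual g W ![i 0, r', i 2, s'] * dual g W ![i 1, r, i 3, s])

/-- Contraction of the first slot of a tensor with a vector. -/
def contract {k : ℕ} (A : Tensor (k + 1)) (u : Fin 4 → ℝ) : Tensor k :=
  fun i => ∑ m, u m * A (Fin.cons m i)

/-- The projector `γ = u ⊗ u + g` in mixed components: `γ_a^b = δ_a^b + u_a u^b`. -/
def projector (g : Matrix (Fin 4) (Fin 4) ℝ) (u : Fin 4 → ℝ) (a b : Fin 4) : ℝ :=
  (if a = b then 1 else 0) + (∑ c, g a c * u c) * u b

/-- The orthogonal projection `A_⊥` of a tensor, every slot being projected with `γ`. -/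
def perp (g : Matrix (Fin 4) (Fin 4) ℝ) (u : Fin 4 → ℝ) {k : ℕ} (A : Tensor k) : Tensor k :=
  fun i => ∑ j : Fin k → Fin 4, (∏ l, projector g u (i l) (j l)) * A j

/-- The metric product `(A, B) = A_{a…} B^{a…}` of two tensors of the same rank. -/
def product (g : Matrix (Fin 4) (Fin 4) ℝ) {k : ℕ} (A B : Tensor k) : ℝ :=
  ∑ i : Fin k → Fin 4, ∑ j : Fin k → Fin 4, (∏ l, g⁻¹ (i l) (j l)) * A i * B j

/-- The modulus `|A| = √(A, A)`. -/
def modulus (g : Matrix (Fin 4) (Fin 4) ℝ) {k : ℕ} (A : Tensor k) : ℝ :=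
  Real.sqrt (product g A A)

/-- The super-energy density `τ = T(u,u,u,u)`. -/
def tau (T : Tensor 4) (u : Fin 4 → ℝ) : ℝ :=
  contract (contract (contract (contract T u) u) u) u ![]

/-- The super-Poynting vector `q_⊥ = -T(u,u,u)_⊥`. -/
def qPerp (g : Matrix (Fin 4) (Fin 4) ℝ) (T : Tensor 4) (u : Fin 4 → ℝ) : Tensor 1 :=
  -perp g u (contract (contract (contract T u) u) u)

/-- The super-stress tensor `t_⊥ = T(u,u)_⊥`. -/
def tPerp (g : Matrix (Fin 4) (Fin 4) ℝ) (T : Tensor 4) (u : Fin 4 → ℝ) : Tensor 2 :=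
  perp g u (contract (contract T u) u)

/-- The stress flux tensor `Q_⊥ = -T(u)_⊥`. -/
def QPerp (g : Matrix (Fin 4) (Fin 4) ℝ) (T : Tensor 4) (u : Fin 4 → ℝ) : Tensor 3 :=
  -perp g u (contract T u)

/-- The stress-stress tensor `T_⊥`. -/
def TPerp (g : Matrix (Fin 4) (Fin 4) ℝ) (T : Tensor 4) (u : Fin 4 → ℝ) : Tensor 4 :=
  perp g u T

/-- The constraints on the super-energy scalars of `T` relative to `u`. -/
def SuperEnergyConstraints (g : Matrix (Fin 4) (Fin 4) ℝ) (T : Tensor 4) (u : Fin 4 → ℝ) : Prop :=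
  modulus g (QPerp g T u) ^ 2 - modulus g (qPerp g T u) ^ 2
      = 3 * (tau T u ^ 2 - modulus g (tPerp g T u) ^ 2) ∧
  0 ≤ 3 * (tau T u ^ 2 - modulus g (tPerp g T u) ^ 2) ∧
  0 ≤ 3 * tau T u - modulus g (TPerp g T u)

/-! Curvature of a metric in local coordinates. -/

/-- The partial derivative `∂_i f` at `x`. -/
def partialDeriv (i : Fin 4) (f : (Fin 4 → ℝ) → ℝ) (x : Fin 4 → ℝ) : ℝ :=
  fderiv ℝ f x (Pi.single i 1)

/-- The Christoffel symbols `Γ^a_{bc}` of the metric `g`. -/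
def christoffel (g : (Fin 4 → ℝ) → Matrix (Fin 4) (Fin 4) ℝ) (a b c : Fin 4)
    (x : Fin 4 → ℝ) : ℝ :=
  (1 / 2) * ∑ d, (g x)⁻¹ a d *
    (partialDeriv b (fun y => g y d c) x + partialDeriv c (fun y => g y d b) x
      - partialDeriv d (fun y => g y b c) x)

/-- The Riemann tensor
`R^a_{bcd} = ∂_c Γ^a_{db} - ∂_d Γ^a_{cb} + Γ^a_{ce} Γ^e_{db} - Γ^a_{de} Γ^e_{cb}`. -/
def riemannUp (g : (Fin 4 → ℝ) → Matrix (Fin 4) (Fin 4) ℝ) (a b c d : Fin 4)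
    (x : Fin 4 → ℝ) : ℝ :=
  partialDeriv c (christoffel g a d b) x - partialDeriv d (christoffel g a c b) x
    + ∑ e, (christoffel g a c e x * christoffel g e d b x
      - christoffel g a d e x * christoffel g e c b x)

/-- The covariant Riemann tensor `R_{abcd} = g_{ae} R^e_{bcd}`. -/
def riemann (g : (Fin 4 → ℝ) → Matrix (Fin 4) (Fin 4) ℝ) (a b c d : Fin 4)
    (x : Fin 4 → ℝ) : ℝ :=
  ∑ e, g x a e * riemannUp g e b c d x

/-- The Ricci tensor `R_{bd} = R^a_{bad}`. -/
def ricci (g : (Fin 4 → ℝ) → Matrix (Fin 4) (Fin 4) ℝ) (b d : Fin 4) (x : Fin 4 → ℝ) : ℝ :=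
  ∑ a, riemannUp g a b a d x

/-- The scalar curvature. -/
def scalarCurv (g : (Fin 4 → ℝ) → Matrix (Fin 4) (Fin 4) ℝ) (x : Fin 4 → ℝ) : ℝ :=
  ∑ b, ∑ d, (g x)⁻¹ b d * ricci g b d x

/-- The Weyl tensor of the four-dimensional metric `g` at the point with coordinates `x`. -/
def weyl (g : (Fin 4 → ℝ) → Matrix (Fin 4) (Fin 4) ℝ) (x : Fin 4 → ℝ) : Tensor 4 := fun i =>
  riemann g (i 0) (i 1) (i 2) (i 3) x
    - (1 / 2) * (g x (i 0) (i 2) * ricci g (i 1) (i 3) x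
      - g x (i 0) (i 3) * ricci g (i 1) (i 2) x
      + g x (i 1) (i 3) * ricci g (i 0) (i 2) x
      - g x (i 1) (i 2) * ricci g (i 0) (i 3) x)
    + (1 / 6) * scalarCurv g x *
      (g x (i 0) (i 2) * g x (i 1) (i 3) - g x (i 0) (i 3) * g x (i 1) (i 2))

/-- `g` is a spacetime metric in the coordinate domain `U`: an open set of `ℝ⁴` on which the
components are twice continuously differentiable and `g` has signature `(-,+,+,+)`. -/
structure IsSpacetimeMetricOn (g : (Fin 4 → ℝ) → Matrix (Fin 4) (Fin 4) ℝ)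
    (U : Set (Fin 4 → ℝ)) : Prop where
  isOpen : IsOpen U
  contDiffOn : ∀ a b, ContDiffOn ℝ 2 (fun x => g x a b) U
  lorentzian : ∀ x ∈ U, IsLorentzian (g x)

end BelRobinson

end

noncomputable section

namespace BelRobinson

/-! All the scalars involved are invariant, so they may be computed in an orthonormal frame whose
first vector is `u`. There a projected tensor keeps exactly its purely spatial components, and its
squared modulus is the sum of their squares (`modulus_perp_sq`). The frame may have either
orientation, but the dual of `W` enters `T` quadratically, so the sign drops out
(`pull_belRobinson`).

In such a frame a Weyl tensor is a symmetric 6×6 matrix on bivectors, with blocks `E, B; B, -E`,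
where the electric and magnetic parts `E`, `B` are symmetric traceless 3×3 matrices
(`IsFrameWeyl.exists_eq`). Duality is (E, B) ↦ (B, -E) (`frameDual_eq`). With S = E² + B², this
gives τ = tr S / 4 and t = ((tr S) δ - 2S) / 4, while q is half the sum of the cross products of
corresponding columns of E and B. Two polynomial identities then follow by expansion: the flux
identity of the theorem (`stressFlux_identity`), and |T_⊥|² = 3τ² - 8|q|² + 6|t|²
(`stressStress_identity`).

Everything thus reduces to |t| ≤ τ, that is 2|S|² ≤ (tr S)² (`superStress_le`). For a symmetric
traceless 3×3 matrix, Cayley–Hamilton gives |E²|² = (tr E²)² / 2, so the inequality is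
Cauchy–Schwarz for E² and B². Consequently |T_⊥|² ≤ 9τ², and τ ≥ 0 allows square roots.

For a spacetime it remains to check that the Weyl tensor of a C² metric has the algebraic
symmetries. They are read off from an expression for the fully covariant Riemann tensor in second
derivatives of `g` and products of Christoffel symbols (`IsSpacetimeMetricOn.riemann_eq`). -/

/-- The signature `(-,+,+,+)`. -/
def sgn : Fin 4 → ℝ := ![-1, 1, 1, 1]

/-! ### Orthonormal frames adapted to an observer -/

/-- `P` is a frame, orthonormal for `g`, with first vector `u`. -/
structure IsFrame (g : Matrix (Fin 4) (Fin 4) ℝ) (u : Fin 4 → ℝ)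
    (P : Matrix (Fin 4) (Fin 4) ℝ) : Prop where
  isUnit_det : IsUnit P.det
  gram : P.transpose * g * P = Matrix.diagonal sgn
  first : ∀ a, P a 0 = u a

lemma exists_lorentz (v : Fin 4 → ℝ) (hv : -v 0 ^ 2 + v 1 ^ 2 + v 2 ^ 2 + v 3 ^ 2 = -1) :
    ∃ L : Matrix (Fin 4) (Fin 4) ℝ,
      L.transpose * Matrix.diagonal sgn * L = Matrix.diagonal sgn ∧ ∀ a, L a 0 = v a := by
  have key : ∀ v : Fin 4 → ℝ, -v 0 ^ 2 + v 1 ^ 2 + v 2 ^ 2 + v 3 ^ 2 = -1 → 0 ≤ v 0 →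
      ∃ L : Matrix (Fin 4) (Fin 4) ℝ,
        L.transpose * Matrix.diagonal sgn * L = Matrix.diagonal sgn ∧ ∀ a, L a 0 = v a := by
    intro v hv h0
    -- The witness is the pure boost taking the time axis to `v`; its spatial block is 1 + v vᵀ / (1
    -- + v⁰), and `k` is the reciprocal of 1 + v⁰.
    obtain ⟨k, hk⟩ : ∃ k : ℝ, k * (1 + v 0) = 1 := ⟨(1 + v 0)⁻¹, inv_mul_cancel₀ (by positivity)⟩
    refine ⟨!![v 0, v 1, v 2, v 3;
      v 1, 1 + k * v 1 * v 1, k * v 1 * v 2, k * v 1 * v 3;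
      v 2, k * v 2 * v 1, 1 + k * v 2 * v 2, k * v 2 * v 3;
      v 3, k * v 3 * v 1, k * v 3 * v 2, 1 + k * v 3 * v 3], ?_, ?_⟩
    · have h1 : k * (v 1 ^ 2 + v 2 ^ 2 + v 3 ^ 2) = v 0 - 1 := by
        linear_combination k * hv + (v 0 - 1) * hk
      have h2 : k * (v 0 - 1) = 1 - 2 * k := by linear_combination hk
      ext i j
      fin_cases i <;> fin_cases j <;>
        simp [Matrix.mul_apply, Fin.sum_univ_four, sgn, Matrix.diagonal]
      · linear_combination hv
      · linear_combination v 1 * h1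
      · linear_combination v 2 * h1
      · linear_combination v 3 * h1
      · linear_combination v 1 * h1
      · linear_combination k * v 1 * v 1 * h1 + v 1 * v 1 * h2
      · linear_combination k * v 1 * v 2 * h1 + v 1 * v 2 * h2
      · linear_combination k * v 1 * v 3 * h1 + v 1 * v 3 * h2
      · linear_combination v 2 * h1
      · linear_combination k * v 1 * v 2 * h1 + v 1 * v 2 * h2
      · linear_combination k * v 2 * v 2 * h1 + v 2 * v 2 * h2
      · linear_combination k * v 2 * v 3 * h1 + v 2 * v 3 * h2
      · linear_combination v 3 * h1
      · linear_combination k * v 1 * v 3 * h1 + v 1 * v 3 * h2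
      · linear_combination k * v 2 * v 3 * h1 + v 2 * v 3 * h2
      · linear_combination k * v 3 * v 3 * h1 + v 3 * v 3 * h2
    · intro a
      fin_cases a <;> simp
  rcases le_total 0 (v 0) with h | h
  · exact key v hv h
  · obtain ⟨L, hL, hv'⟩ := key (-v) (by simpa using hv) (by simpa using h)
    exact ⟨-L, by simpa using hL, fun a => by simp [hv']⟩

/-- Any orthonormal basis `P` is corrected by a Lorentz transformation whose first column consists
of the components of `u` in `P`. -/
lemma exists_frame {g : Matrix (Fin 4) (Fin 4) ℝ} {u : Fin 4 → ℝ} (hg : IsLorentzian g)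
    (hu : IsObserver g u) : ∃ P, IsFrame g u P := by
  obtain ⟨-, P, hP, hgP⟩ := hg
  have hPu : P.mulVec (P⁻¹.mulVec u) = u := by
    rw [Matrix.mulVec_mulVec, Matrix.mul_nonsing_inv _ hP, Matrix.one_mulVec]
  have hq : ∀ v : Fin 4 → ℝ, v ⬝ᵥ (P.transpose * g * P).mulVec v
      = ∑ a, ∑ b, g a b * P.mulVec v a * P.mulVec v b := by
    intro v
    rw [Matrix.mul_assoc, ← Matrix.mulVec_mulVec, Matrix.dotProduct_mulVec, Matrix.vecMul_transpose,
      ← Matrix.mulVec_mulVec]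
    simp only [dotProduct, Matrix.mulVec, Finset.mul_sum]
    refine Finset.sum_congr rfl fun a _ => Finset.sum_congr rfl fun b _ => ?_
    simp only [Finset.sum_mul]
    refine Finset.sum_congr rfl fun c _ => Finset.sum_congr rfl fun d _ => ?_
    ring
  obtain ⟨L, hL, hL0⟩ := exists_lorentz (P⁻¹.mulVec u) (by
    have := hq (P⁻¹.mulVec u)
    rw [hPu, hu, hgP] at this
    rw [← this]
    simp [dotProduct, Fin.sum_univ_four, Matrix.mulVec_diagonal]
    ring)
  have hdet : IsUnit L.det := by
    have := congrArg Matrix.det hL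
    simp only [Matrix.det_mul, Matrix.det_transpose, Matrix.det_diagonal] at this
    rw [isUnit_iff_ne_zero]
    intro h0
    rw [h0] at this
    simp [Fin.prod_univ_four, sgn] at this
  refine ⟨P * L, ?_, ?_, ?_⟩
  · rw [Matrix.det_mul]
    exact hP.mul hdet
  · rw [Matrix.transpose_mul, ← hL]
    have : Matrix.diagonal sgn = P.transpose * g * P := hgP.symm
    rw [this]
    simp only [Matrix.mul_assoc]
  · intro a
    conv_rhs => rw [← hPu]
    simp only [Matrix.mul_apply, Matrix.mulVec, dotProduct, hL0]

section Frame

variable {g : Matrix (Fin 4) (Fin 4) ℝ} {u : Fin 4 → ℝ} {P : Matrix (Fin 4) (Fin 4) ℝ}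

lemma IsFrame.inv_eq (hP : IsFrame g u P) : g⁻¹ = P * Matrix.diagonal sgn * P.transpose := by
  have hd : Matrix.diagonal sgn * Matrix.diagonal sgn = (1 : Matrix (Fin 4) (Fin 4) ℝ) := by
    rw [Matrix.diagonal_mul_diagonal, ← Matrix.diagonal_one]
    congr 1
    ext i
    fin_cases i <;> simp [sgn]
  have hPP : P * P⁻¹ = 1 := Matrix.mul_nonsing_inv _ hP.isUnit_det
  have hPP' : P⁻¹ * P = 1 := Matrix.nonsing_inv_mul _ hP.isUnit_det
  apply Matrix.inv_eq_left_inv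
  have : P.transpose * g = Matrix.diagonal sgn * P⁻¹ := by
    rw [← hP.gram, Matrix.mul_assoc _ P, hPP, Matrix.mul_one]
  rw [Matrix.mul_assoc, this, Matrix.mul_assoc, ← Matrix.mul_assoc (Matrix.diagonal sgn), hd,
    Matrix.one_mul, hPP]

lemma IsFrame.inv_apply (hP : IsFrame g u P) (i j : Fin 4) :
    g⁻¹ i j = ∑ m, sgn m * P i m * P j m := by
  rw [hP.inv_eq, Matrix.mul_apply]
  simp only [Matrix.mul_diagonal, Matrix.transpose_apply]
  exact Finset.sum_congr rfl fun m _ => by ring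

/-- Taking determinants in the Gram relation gives det g · (det P)² = -1. The sign of det P, the
orientation of the frame, remains free. -/
lemma IsFrame.det_sq (hP : IsFrame g u P) : (Real.sqrt |g.det| * P.det) ^ 2 = 1 := by
  have := congrArg Matrix.det hP.gram
  simp only [Matrix.det_mul, Matrix.det_transpose, Matrix.det_diagonal] at this
  rw [mul_pow, Real.sq_sqrt (abs_nonneg _), ← abs_of_nonneg (sq_nonneg P.det), ← abs_mul,
    show g.det * P.det ^ 2 = P.det * g.det * P.det by ring, this]
  simp [Fin.prod_univ_four, sgn]

/-! ### Tensor operations in frame components -/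

/-- The components of a tensor in the frame `P`. -/
def pull (P : Matrix (Fin 4) (Fin 4) ℝ) {k : ℕ} (A : Tensor k) : Tensor k :=
  fun i => ∑ j : Fin k → Fin 4, (∏ l, P (j l) (i l)) * A j

lemma product_eq_sum (hP : IsFrame g u P) {k : ℕ} (A : Tensor k) :
    product g A A = ∑ m : Fin k → Fin 4, (∏ l, sgn (m l)) * pull P A m ^ 2 := by
  simp only [product, hP.inv_apply, Finset.prod_univ_sum, Fintype.piFinset_univ, pull, sq,
    Finset.mul_sum, Finset.sum_mul]
  conv_rhs => rw [Finset.sum_comm]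
  refine Finset.sum_congr rfl fun i _ => ?_
  conv_rhs => rw [Finset.sum_comm]
  refine Finset.sum_congr rfl fun j _ => Finset.sum_congr rfl fun m _ => ?_
  simp only [Finset.prod_mul_distrib]
  ring

/-- In the frame the projector is diag(0, 1, 1, 1). -/
lemma pull_perp (hP : IsFrame g u P) {k : ℕ} (A : Tensor k) (i : Fin k → Fin 4) :
    pull P (perp g u A) i = if ∃ l, i l = 0 then 0 else pull P A i := by
  have key : ∀ m b, ∑ a, P a m * projector g u a b = if m = 0 then 0 else P b m := by
    intro m b
    have h1 : ∑ a, P a m * ∑ c, g a c * u c = if m = 0 then -1 else 0 := by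
      have := congrFun (congrFun hP.gram m) 0
      rw [Matrix.mul_assoc, Matrix.mul_apply] at this
      simp only [Matrix.mul_apply, Matrix.transpose_apply, hP.first] at this
      rw [this]
      fin_cases m <;> simp [sgn, Matrix.diagonal]
    simp only [projector, mul_add, Finset.sum_add_distrib, ← mul_assoc, ← Finset.sum_mul, h1]
    by_cases hm : m = 0 <;> simp [hm, hP.first]
  simp only [pull, perp, Finset.mul_sum]
  rw [Finset.sum_comm]
  have : ∀ j : Fin k → Fin 4, ∑ a : Fin k → Fin 4, (∏ l, P (a l) (i l)) *
      ((∏ l, projector g u (a l) (j l)) * A j)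
      = (∏ l, if i l = 0 then 0 else P (j l) (i l)) * A j := by
    intro j
    simp only [← key, Finset.prod_univ_sum, Fintype.piFinset_univ, Finset.sum_mul,
      Finset.prod_mul_distrib, mul_assoc]
  simp only [this]
  split_ifs with h
  · obtain ⟨l, hl⟩ := h
    refine Finset.sum_eq_zero fun j _ => ?_
    rw [Finset.prod_eq_zero (Finset.mem_univ l) (by simp [hl]), zero_mul]
  · push Not at h
    simp [h]

/-- On spatial indices the metric is the identity, so (A_⊥, A_⊥) is nonnegative and squaring really
undoes the square root. -/
lemma modulus_perp_sq (hP : IsFrame g u P) {k : ℕ} (A : Tensor k) :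
    modulus g (perp g u A) ^ 2 = ∑ i : Fin k → Fin 3, pull P A (fun l => (i l).succ) ^ 2 := by
  have : product g (perp g u A) (perp g u A)
      = ∑ i : Fin k → Fin 3, pull P A (fun l => (i l).succ) ^ 2 := by
    rw [product_eq_sum hP]
    symm
    apply Fintype.sum_of_injective (fun (i : Fin k → Fin 3) l => (i l).succ)
    · intro i j h
      funext l
      simpa using congrFun h l
    · intro m hm
      rw [pull_perp hP, if_pos, zero_pow two_ne_zero, mul_zero]
      by_contra! h
      exact hm ⟨fun l => (m l).pred (h l), by simp⟩
    · intro i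
      have hs : ∀ j : Fin 3, sgn j.succ = 1 := by
        intro j
        fin_cases j <;> simp [sgn]
      rw [pull_perp hP, if_neg (by simp [Fin.succ_ne_zero])]
      simp [hs]
  rw [modulus, this, Real.sq_sqrt (Finset.sum_nonneg fun _ _ => sq_nonneg _)]

lemma modulus_neg {k : ℕ} (A : Tensor k) : modulus g (-A) = modulus g A := by
  simp [modulus, product]

lemma sum_fin_succ_arrow {α M : Type*} [Fintype α] [AddCommMonoid M] {k : ℕ}
    (f : (Fin (k + 1) → α) → M) : ∑ i, f i = ∑ a, ∑ i : Fin k → α, f (Fin.cons a i) := by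
  rw [← (Fin.consEquiv (fun _ => α)).sum_comp, Fintype.sum_prod_type]
  rfl

lemma pull_contract (hP : IsFrame g u P) {k : ℕ} (A : Tensor (k + 1)) (i : Fin k → Fin 4) :
    pull P (contract A u) i = pull P A (Fin.cons 0 i) := by
  simp only [pull, contract, sum_fin_succ_arrow, Fin.prod_univ_succ, Fin.cons_zero, Fin.cons_succ,
    hP.first, Finset.mul_sum]
  rw [Finset.sum_comm]
  refine Finset.sum_congr rfl fun m _ => Finset.sum_congr rfl fun j _ => ?_
  ring

lemma tau_eq (hP : IsFrame g u P) (T : Tensor 4) : tau T u = pull P T ![0, 0, 0, 0] := by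
  have h : ∀ A : Tensor 0, A ![] = pull P A ![] := by
    intro A
    simp only [pull, Finset.univ_eq_empty, Finset.prod_empty, one_mul, Fintype.sum_unique]
    exact congrArg A (Subsingleton.elim _ _)
  rw [tau, h (contract _ _)]
  simp only [pull_contract hP]
  rfl

lemma qPerp_sq (hP : IsFrame g u P) (T : Tensor 4) :
    modulus g (qPerp g T u) ^ 2 = ∑ i : Fin 3, pull P T ![0, 0, 0, i.succ] ^ 2 := by
  rw [qPerp, modulus_neg, modulus_perp_sq hP]
  simp only [pull_contract hP, sum_fin_succ_arrow, Fintype.sum_unique]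
  refine Finset.sum_congr rfl fun i _ => ?_
  congr 2
  ext l
  fin_cases l <;> rfl

lemma tPerp_sq (hP : IsFrame g u P) (T : Tensor 4) :
    modulus g (tPerp g T u) ^ 2
      = ∑ i : Fin 3, ∑ j : Fin 3, pull P T ![0, 0, i.succ, j.succ] ^ 2 := by
  rw [tPerp, modulus_perp_sq hP]
  simp only [pull_contract hP, sum_fin_succ_arrow, Fintype.sum_unique]
  refine Finset.sum_congr rfl fun i _ => Finset.sum_congr rfl fun j _ => ?_
  congr 2
  ext l
  fin_cases l <;> rfl

lemma QPerp_sq (hP : IsFrame g u P) (T : Tensor 4) :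
    modulus g (QPerp g T u) ^ 2
      = ∑ i : Fin 3, ∑ j : Fin 3, ∑ k : Fin 3, pull P T ![0, i.succ, j.succ, k.succ] ^ 2 := by
  rw [QPerp, modulus_neg, modulus_perp_sq hP]
  simp only [pull_contract hP, sum_fin_succ_arrow, Fintype.sum_unique]
  refine Finset.sum_congr rfl fun i _ => Finset.sum_congr rfl fun j _ =>
    Finset.sum_congr rfl fun k _ => ?_
  congr 2
  ext l
  fin_cases l <;> rfl

lemma TPerp_sq (hP : IsFrame g u P) (T : Tensor 4) :
    modulus g (TPerp g T u) ^ 2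
      = ∑ h : Fin 3, ∑ i : Fin 3, ∑ j : Fin 3, ∑ k : Fin 3,
        pull P T ![h.succ, i.succ, j.succ, k.succ] ^ 2 := by
  rw [TPerp, modulus_perp_sq hP]
  simp only [sum_fin_succ_arrow, Fintype.sum_unique]
  refine Finset.sum_congr rfl fun h _ => Finset.sum_congr rfl fun i _ =>
    Finset.sum_congr rfl fun j _ => Finset.sum_congr rfl fun k _ => ?_
  congr 2
  ext l
  fin_cases l <;> rfl

lemma pull_four (A : Tensor 4) (a b c d : Fin 4) :
    pull P A ![a, b, c, d]
      = ∑ a', ∑ b', ∑ c', ∑ d', P a' a * P b' b * P c' c * P d' d * A ![a', b', c', d'] := by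
  simp only [pull, sum_fin_succ_arrow, Fintype.sum_unique, Fin.prod_univ_four]
  refine Finset.sum_congr rfl fun a' _ => Finset.sum_congr rfl fun b' _ =>
    Finset.sum_congr rfl fun c' _ => Finset.sum_congr rfl fun d' _ => ?_
  rfl

/-- The symbol is the determinant of the matrix with rows e_{i_k}. Multiplying it by Pᵀ and
expanding the determinant multilinearly in the rows gives the transformation law. -/
lemma pull_volumeElement (i : Fin 4 → Fin 4) :
    pull P (volumeElement g) i = Real.sqrt |g.det| * P.det * leviCivita i := by
  have h : ∑ j : Fin 4 → Fin 4, (∏ l, P (j l) (i l)) * leviCivita j = leviCivita i * P.det := by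
    have h1 : leviCivita i * P.det
        = Matrix.detRowAlternating (fun k : Fin 4 => ∑ c, P c (i k) • Pi.single c (1 : ℝ)) := by
      rw [leviCivita, ← Matrix.det_transpose P, ← Matrix.det_mul]
      refine congrArg Matrix.det ?_
      ext k c
      simp [Matrix.mul_apply, Pi.single_apply]
    rw [h1, ← AlternatingMap.coe_multilinearMap, MultilinearMap.map_sum]
    refine Finset.sum_congr rfl fun j _ => ?_
    rw [MultilinearMap.map_smul_univ, smul_eq_mul, leviCivita]
    congr 1
    refine congrArg Matrix.det ?_
    ext k c
    simp [Pi.single_apply, eq_comm]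
  rw [pull, mul_assoc, mul_comm P.det, ← h, Finset.mul_sum]
  refine Finset.sum_congr rfl fun j _ => ?_
  rw [volumeElement]
  ring

/-- Both sides are traces of matrix products, matched by g⁻¹ = P · diag · Pᵀ and cyclicity of the
trace. -/
lemma contract_pair (hP : IsFrame g u P) (X Y : Matrix (Fin 4) (Fin 4) ℝ) :
    ∑ r, ∑ s, ∑ r', ∑ s', X r s * g⁻¹ r r' * g⁻¹ s s' * Y r' s'
      = ∑ m, ∑ n, sgn m * sgn n * (∑ r, ∑ s, P r m * P s n * X r s)
          * (∑ r', ∑ s', P r' m * P s' n * Y r' s') := by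
  have h : ∀ (X Y : Matrix (Fin 4) (Fin 4) ℝ),
      ∑ r, ∑ s, ∑ r', ∑ s', X r s * g⁻¹ r r' * g⁻¹ s s' * Y r' s'
        = ∑ r, ∑ s, X r s * (g⁻¹ * Y * g⁻¹.transpose) r s := by
    intro X Y
    refine Finset.sum_congr rfl fun r _ => Finset.sum_congr rfl fun s _ => ?_
    simp only [Matrix.mul_apply, Finset.mul_sum, Finset.sum_mul, Matrix.transpose_apply]
    rw [Finset.sum_comm]
    refine Finset.sum_congr rfl fun r' _ => Finset.sum_congr rfl fun s' _ => ?_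
    ring
  have h' : ∀ (X : Matrix (Fin 4) (Fin 4) ℝ) m n,
      ∑ r, ∑ s, P r m * P s n * X r s = (P.transpose * X * P) m n := by
    intro X m n
    simp only [Matrix.mul_apply, Finset.sum_mul, Matrix.transpose_apply]
    rw [Finset.sum_comm]
    refine Finset.sum_congr rfl fun r _ => Finset.sum_congr rfl fun s _ => ?_
    ring
  have h3 : ∀ (X Z : Matrix (Fin 4) (Fin 4) ℝ), ∑ m, ∑ n, X m n * Z m n
      = (X * Z.transpose).trace := by
    intro X Z
    simp [Matrix.trace, Matrix.mul_apply]
  have h4 : ∀ (X Z : Matrix (Fin 4) (Fin 4) ℝ), ∑ m, ∑ n, sgn m * sgn n * X m n * Z m n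
      = (X * (Matrix.diagonal sgn * Z * Matrix.diagonal sgn).transpose).trace := by
    intro X Z
    rw [← h3]
    simp only [Matrix.mul_diagonal, Matrix.diagonal_mul]
    refine Finset.sum_congr rfl fun r _ => Finset.sum_congr rfl fun s _ => ?_
    ring
  rw [h, h3]
  simp only [h']
  rw [h4, hP.inv_eq]
  simp only [Matrix.transpose_mul, Matrix.transpose_transpose, Matrix.diagonal_transpose,
    Matrix.mul_assoc]
  rw [Matrix.trace_mul_comm P.transpose]
  simp only [Matrix.mul_assoc]

/-- The dual of `w` in an orthonormal frame. -/
def frameDual (w : Tensor 4) (a b c d : Fin 4) : ℝ :=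
  (1 / 2) * ∑ m, ∑ n, sgn m * sgn n * leviCivita ![a, b, m, n] * w ![m, n, c, d]

/-- Taking frame components commutes with a contraction. Its index types are instantiated by pairs
of tensor indices, both for the dual and for the quadratic terms of `T`. -/
lemma sum_mul_sum_mul_sum {α β γ : Type*} [Fintype α] [Fintype β] [Fintype γ]
    (p : α → ℝ) (q : β → ℝ) (κ : ℝ) (σ : γ → ℝ) (V : α → γ → ℝ) (W : γ → β → ℝ) :
    ∑ x, ∑ y, p x * q y * (κ * ∑ m, σ m * V x m * W m y)
      = κ * ∑ m, σ m * (∑ x, p x * V x m) * ∑ y, q y * W m y := by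
  simp only [Finset.mul_sum, Finset.sum_mul]
  conv_rhs => rw [Finset.sum_comm]
  rw [Finset.sum_comm]
  refine Finset.sum_congr rfl fun y _ => ?_
  rw [Finset.sum_comm]
  refine Finset.sum_congr rfl fun m _ => Finset.sum_congr rfl fun x _ => ?_
  ring

lemma pull_pairs (A : Tensor 4) (a b c d : Fin 4) :
    pull P A ![a, b, c, d] = ∑ x : Fin 4 × Fin 4, ∑ y : Fin 4 × Fin 4,
      P x.1 a * P x.2 b * (P y.1 c * P y.2 d) * A ![x.1, x.2, y.1, y.2] := by
  simp only [pull_four, Fintype.sum_prod_type, mul_assoc]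

lemma pull_alternate (A : Tensor 4) (a b c d : Fin 4) :
    pull P A ![a, b, c, d] = ∑ x : Fin 4 × Fin 4, ∑ y : Fin 4 × Fin 4,
      P x.1 a * P x.2 c * (P y.1 b * P y.2 d) * A ![x.1, y.1, x.2, y.2] := by
  simp only [pull_four, Fintype.sum_prod_type]
  refine Finset.sum_congr rfl fun a' _ => ?_
  rw [Finset.sum_comm]
  refine Finset.sum_congr rfl fun c' _ => Finset.sum_congr rfl fun b' _ =>
    Finset.sum_congr rfl fun d' _ => ?_
  ring

lemma pull_dual (hP : IsFrame g u P) (W : Tensor 4) (a b c d : Fin 4) :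
    pull P (dual g W) ![a, b, c, d]
      = Real.sqrt |g.det| * P.det * frameDual (pull P W) a b c d := by
  have h1 : ∀ i : Fin 4 → Fin 4, dual g W i = (1 / 2) * ∑ z : Fin 4 × Fin 4, sgn z.1 * sgn z.2 *
      (∑ y : Fin 4 × Fin 4, P y.1 z.1 * P y.2 z.2 * volumeElement g ![i 0, i 1, y.1, y.2]) *
      (∑ y : Fin 4 × Fin 4, P y.1 z.1 * P y.2 z.2 * W ![y.1, y.2, i 2, i 3]) := by
    intro i
    simp only [dual, Fintype.sum_prod_type]
    congr 1
    exact contract_pair hP (fun r s => volumeElement g ![i 0, i 1, r, s])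
      (fun r s => W ![r, s, i 2, i 3])
  have h2 : ∀ m n, Real.sqrt |g.det| * P.det * leviCivita ![a, b, m, n] =
      ∑ x : Fin 4 × Fin 4, P x.1 a * P x.2 b *
        ∑ y : Fin 4 × Fin 4, P y.1 m * P y.2 n * volumeElement g ![x.1, x.2, y.1, y.2] := by
    intro m n
    rw [← pull_volumeElement, pull_pairs]
    simp only [Finset.mul_sum, mul_assoc]
  have h3 : ∀ m n, pull P W ![m, n, c, d] =
      ∑ y : Fin 4 × Fin 4, P y.1 c * P y.2 d *
        ∑ x : Fin 4 × Fin 4, P x.1 m * P x.2 n * W ![x.1, x.2, y.1, y.2] := by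
    intro m n
    rw [pull_pairs, Finset.sum_comm]
    simp only [Finset.mul_sum]
    refine Finset.sum_congr rfl fun _ _ => Finset.sum_congr rfl fun _ _ => ?_
    ring
  rw [pull_pairs]
  simp only [h1]
  refine (sum_mul_sum_mul_sum (fun x : Fin 4 × Fin 4 => P x.1 a * P x.2 b)
    (fun y : Fin 4 × Fin 4 => P y.1 c * P y.2 d) (1 / 2)
    (fun z : Fin 4 × Fin 4 => sgn z.1 * sgn z.2)
    (fun x z => ∑ y : Fin 4 × Fin 4, P y.1 z.1 * P y.2 z.2 * volumeElement g ![x.1, x.2, y.1, y.2])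
    (fun z y => ∑ x : Fin 4 × Fin 4, P x.1 z.1 * P x.2 z.2 * W ![x.1, x.2, y.1, y.2])).trans ?_
  simp only [← h2, ← h3]
  simp only [frameDual, Fintype.sum_prod_type, Finset.mul_sum]
  refine Finset.sum_congr rfl fun _ _ => Finset.sum_congr rfl fun _ _ => ?_
  ring

/-- The quadratic form `∑ w_{a m c n} w_{b m d n}` in an orthonormal frame. -/
def frameSquare (w : Fin 4 → Fin 4 → Fin 4 → Fin 4 → ℝ) (a b c d : Fin 4) : ℝ :=
  ∑ m, ∑ n, sgn m * sgn n * w a m c n * w b m d n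

/-- The Bel-Robinson tensor of `w` in an orthonormal frame. -/
def frameBelRobinson (w : Tensor 4) (a b c d : Fin 4) : ℝ :=
  (1 / 4) * (frameSquare (fun a b c d => w ![a, b, c, d]) a b c d
    + frameSquare (frameDual w) a b c d)

lemma pull_square (hP : IsFrame g u P) (W : Tensor 4) (a b c d : Fin 4) :
    pull P (fun i => ∑ r, ∑ r', ∑ s, ∑ s', g⁻¹ r r' * g⁻¹ s s' *
      (W ![i 0, r', i 2, s'] * W ![i 1, r, i 3, s])) ![a, b, c, d]
      = frameSquare (fun a b c d => pull P W ![a, b, c, d]) a b c d := by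
  have hsymm : ∀ i j, g⁻¹ i j = g⁻¹ j i := by
    intro i j
    simp only [hP.inv_apply]
    exact Finset.sum_congr rfl fun m _ => by ring
  have h1 : ∀ a b c d, ∑ r, ∑ r', ∑ s, ∑ s', g⁻¹ r r' * g⁻¹ s s' *
      (W ![a, r', c, s'] * W ![b, r, d, s]) = 1 * ∑ z : Fin 4 × Fin 4, sgn z.1 * sgn z.2 *
      (∑ y : Fin 4 × Fin 4, P y.1 z.1 * P y.2 z.2 * W ![a, y.1, c, y.2]) *
      (∑ y : Fin 4 × Fin 4, P y.1 z.1 * P y.2 z.2 * W ![b, y.1, d, y.2]) := by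
    intro a b c d
    simp only [Fintype.sum_prod_type, one_mul]
    refine Eq.trans ?_ (contract_pair hP (fun r s => W ![a, r, c, s]) (fun r s => W ![b, r, d, s]))
    rw [Finset.sum_comm]
    refine Finset.sum_congr rfl fun r' _ => ?_
    conv_lhs => enter [2, r]; rw [Finset.sum_comm]
    rw [Finset.sum_comm]
    refine Finset.sum_congr rfl fun s' _ => Finset.sum_congr rfl fun r _ =>
      Finset.sum_congr rfl fun s _ => ?_
    rw [hsymm r, hsymm s]
    ring
  have h2 : ∀ a c m n, pull P W ![a, m, c, n] = ∑ x : Fin 4 × Fin 4, P x.1 a * P x.2 c *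
      ∑ y : Fin 4 × Fin 4, P y.1 m * P y.2 n * W ![x.1, y.1, x.2, y.2] := by
    intro a c m n
    rw [pull_alternate]
    simp only [Finset.mul_sum, mul_assoc]
  rw [pull_alternate]
  simp only [h1]
  refine (sum_mul_sum_mul_sum (fun x : Fin 4 × Fin 4 => P x.1 a * P x.2 c)
    (fun y : Fin 4 × Fin 4 => P y.1 b * P y.2 d) 1
    (fun z : Fin 4 × Fin 4 => sgn z.1 * sgn z.2)
    (fun x z => ∑ y : Fin 4 × Fin 4, P y.1 z.1 * P y.2 z.2 * W ![x.1, y.1, x.2, y.2])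
    (fun z x => ∑ y : Fin 4 × Fin 4, P y.1 z.1 * P y.2 z.2 * W ![x.1, y.1, x.2, y.2])).trans ?_
  simp only [← h2]
  simp only [frameSquare, Fintype.sum_prod_type, one_mul]

lemma pull_belRobinson (hP : IsFrame g u P) (W : Tensor 4) (a b c d : Fin 4) :
    pull P (belRobinson g W) ![a, b, c, d] = frameBelRobinson (pull P W) a b c d := by
  have h : pull P (belRobinson g W) ![a, b, c, d] = (1 / 4) *
      (frameSquare (fun a b c d => pull P W ![a, b, c, d]) a b c d
        + frameSquare (fun a b c d => pull P (dual g W) ![a, b, c, d]) a b c d) := by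
    rw [← pull_square hP, ← pull_square hP]
    simp only [pull, belRobinson, Finset.mul_sum, ← Finset.sum_add_distrib]
    iterate 5 refine Finset.sum_congr rfl fun _ _ => ?_
    ring
  rw [h, frameBelRobinson]
  congr 2
  -- Each dual carries a factor `s = ±1`; their product is `s ^ 2 = 1`.
  have hs := hP.det_sq
  set s := Real.sqrt |g.det| * P.det
  simp only [frameSquare, pull_dual hP]
  refine Finset.sum_congr rfl fun m _ => Finset.sum_congr rfl fun n _ => ?_
  linear_combination (sgn m * sgn n * frameDual (pull P W) a m c n *
    frameDual (pull P W) b m d n) * hs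

/-- The symmetries of a Weyl tensor in an orthonormal frame. -/
structure IsFrameWeyl (w : Tensor 4) : Prop where
  antisymm_left : ∀ a b c d, w ![a, b, c, d] = -w ![b, a, c, d]
  antisymm_right : ∀ a b c d, w ![a, b, c, d] = -w ![a, b, d, c]
  pair_symm : ∀ a b c d, w ![a, b, c, d] = w ![c, d, a, b]
  cyclic : ∀ a b c d, w ![a, b, c, d] + w ![a, c, d, b] + w ![a, d, b, c] = 0
  traceless : ∀ b d, ∑ a, sgn a * w ![a, b, a, d] = 0

lemma IsWeylTensor.pull (hP : IsFrame g u P) {W : Tensor 4} (hW : IsWeylTensor g W) :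
    IsFrameWeyl (pull P W) where
  antisymm_left a b c d := by
    simp only [pull_four]
    rw [Finset.sum_comm]
    simp only [← Finset.sum_neg_distrib]
    iterate 4 refine Finset.sum_congr rfl fun _ _ => ?_
    rw [hW.antisymm_left]
    ring
  antisymm_right a b c d := by
    simp only [pull_four, ← Finset.sum_neg_distrib]
    iterate 2 refine Finset.sum_congr rfl fun _ _ => ?_
    rw [Finset.sum_comm]
    iterate 2 refine Finset.sum_congr rfl fun _ _ => ?_
    rw [hW.antisymm_right]
    ring
  pair_symm a b c d := by
    simp only [pull_pairs]
    rw [Finset.sum_comm]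
    iterate 2 refine Finset.sum_congr rfl fun _ _ => ?_
    rw [hW.pair_symm]
    ring
  cyclic a b c d := by
    have h1 : BelRobinson.pull P W ![a, c, d, b] = ∑ a', ∑ b', ∑ c', ∑ d',
        P a' a * P b' b * P c' c * P d' d * W ![a', c', d', b'] := by
      rw [pull_four]
      refine Finset.sum_congr rfl fun _ _ => ?_
      conv_rhs => rw [Finset.sum_comm]
      refine Finset.sum_congr rfl fun _ _ => ?_
      conv_rhs => rw [Finset.sum_comm]
      iterate 2 refine Finset.sum_congr rfl fun _ _ => ?_
      ring
    have h2 : BelRobinson.pull P W ![a, d, b, c] = ∑ a', ∑ b', ∑ c', ∑ d',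
        P a' a * P b' b * P c' c * P d' d * W ![a', d', b', c'] := by
      rw [pull_four]
      refine Finset.sum_congr rfl fun _ _ => ?_
      rw [Finset.sum_comm]
      refine Finset.sum_congr rfl fun _ _ => ?_
      rw [Finset.sum_comm]
      iterate 2 refine Finset.sum_congr rfl fun _ _ => ?_
      ring
    rw [h1, h2, pull_four]
    simp only [← Finset.sum_add_distrib]
    iterate 4 refine Finset.sum_eq_zero fun _ _ => ?_
    rw [← mul_add, ← mul_add, hW.cyclic, mul_zero]
  traceless b d := by
    have h0 : ∀ b' d', ∑ a, ∑ c, g⁻¹ a c * W ![a, b', c, d'] = ∑ x : Fin 4 × Fin 4, ∑ m,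
        sgn m * P x.1 m * P x.2 m * W ![x.1, b', x.2, d'] := by
      intro b' d'
      simp only [hP.inv_apply, Finset.sum_mul, Fintype.sum_prod_type]
    have h : ∑ a, sgn a * BelRobinson.pull P W ![a, b, a, d] = ∑ y : Fin 4 × Fin 4,
        P y.1 b * P y.2 d * ∑ a, ∑ c, g⁻¹ a c * W ![a, y.1, c, y.2] := by
      simp only [pull_alternate, h0, Finset.mul_sum]
      rw [Finset.sum_comm]
      conv_rhs => rw [Finset.sum_comm]
      refine Finset.sum_congr rfl fun x _ => ?_
      rw [Finset.sum_comm]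
      refine Finset.sum_congr rfl fun y _ => Finset.sum_congr rfl fun m _ => ?_
      ring
    rw [h]
    simp only [hW.traceless, mul_zero, Finset.sum_const_zero]

end Frame

/-! ### Weyl tensors as matrices on bivectors: electric and magnetic parts -/

/-- The sign of the pair `(a, b)` relative to the basis `01, 02, 03, 23, 31, 12` of bivectors. -/
def pairSign : Fin 4 → Fin 4 → ℝ :=
  ![![0, 1, 1, 1], ![-1, 0, 1, -1], ![-1, -1, 0, 1], ![-1, 1, -1, 0]]

/-- The position of the pair `(a, b)` in the basis `01, 02, 03; 23, 31, 12` of bivectors. -/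
def pairIndex : Fin 4 → Fin 4 → Fin 2 × Fin 3 :=
  ![![(0, 0), (0, 0), (0, 1), (0, 2)], ![(0, 0), (0, 0), (1, 2), (1, 1)],
    ![(0, 1), (1, 2), (0, 0), (1, 0)], ![(0, 2), (1, 1), (1, 0), (0, 0)]]

/-- The basis `01, 02, 03; 23, 31, 12` of bivectors. -/
def pairBasis (x : Fin 2 × Fin 3) : Fin 4 × Fin 4 :=
  !![(0, 1), (0, 2), (0, 3); (2, 3), (3, 1), (1, 2)] x.1 x.2

/-- On a repeated pair `pairIndex` takes the dummy value `(0, 0)`, which is harmless because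
`pairSign` vanishes there. -/
lemma eq_pairSign_mul {A : Tensor 4} (hl : ∀ a b c d, A ![a, b, c, d] = -A ![b, a, c, d])
    (hr : ∀ a b c d, A ![a, b, c, d] = -A ![a, b, d, c]) (a b c d : Fin 4) :
    A ![a, b, c, d] = pairSign a b * pairSign c d *
      A ![(pairBasis (pairIndex a b)).1, (pairBasis (pairIndex a b)).2,
        (pairBasis (pairIndex c d)).1, (pairBasis (pairIndex c d)).2] := by
  have key : ∀ X : Fin 4 → Fin 4 → ℝ, (∀ a b, X a b = -X b a) → ∀ a b, X a b
      = pairSign a b * X (pairBasis (pairIndex a b)).1 (pairBasis (pairIndex a b)).2 := by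
    intro X hX a b
    have hdiag : ∀ a, X a a = 0 := fun a => by linarith [hX a a]
    fin_cases a <;> fin_cases b <;> simp [pairBasis, pairSign, pairIndex, hdiag] <;> exact hX _ _
  rw [key (fun a b => A ![a, b, c, d]) (fun a b => hl a b c d),
    key (fun c d => A ![_, _, c, d]) (fun c d => hr _ _ c d), mul_assoc]

/-- On bivectors the symbol exchanges complementary pairs, 01 with 23, 02 with 31 and 03 with 12.
The ordering 31 makes all these signs positive. -/
lemma leviCivita_eq (a b m n : Fin 4) :
    leviCivita ![a, b, m, n] = pairSign a b * pairSign m n *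
      if (pairIndex a b).1 ≠ (pairIndex m n).1 ∧ (pairIndex a b).2 = (pairIndex m n).2
        then 1 else 0 := by
  have hperm : ∀ (v : Fin 4 → Fin 4) (i j : Fin 4), i ≠ j →
      leviCivita v = -leviCivita (v ∘ Equiv.swap i j) := by
    intro v i j hij
    have := Matrix.det_permute (Equiv.swap i j)
      (Matrix.of fun i j : Fin 4 => if v i = j then (1 : ℝ) else 0)
    rw [Equiv.Perm.sign_swap hij] at this
    simp only [leviCivita]
    rw [← neg_eq_iff_eq_neg]
    rw [Units.val_neg, Units.val_one, Int.cast_neg, Int.cast_one, neg_one_mul] at this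
    exact this.symm
  have hzero : ∀ v : Fin 4 → Fin 4, (∃ i j, i ≠ j ∧ v i = v j) → leviCivita v = 0 := by
    rintro v ⟨i, j, hij, h⟩
    refine Matrix.det_zero_of_row_eq hij ?_
    funext k
    change (if v i = k then (1 : ℝ) else 0) = if v j = k then 1 else 0
    rw [h]
  rw [eq_pairSign_mul (A := leviCivita)]
  · congr 1
    generalize pairIndex a b = x
    generalize pairIndex m n = y
    obtain ⟨x1, x2⟩ := x
    obtain ⟨y1, y2⟩ := y
    fin_cases x1 <;> fin_cases x2 <;> fin_cases y1 <;> fin_cases y2 <;>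
      first
      | exact (hzero _ (by decide)).trans (by simp)
      | simp [pairBasis, leviCivita, Matrix.det_succ_row_zero, Fin.sum_univ_succ,
          show Fin.succAbove (2 : Fin 4) 2 = 3 from rfl,
          show Fin.succAbove (3 : Fin 4) 2 = 2 from rfl,
          show Fin.succAbove (1 : Fin 4) 2 = 3 from rfl, Odd.neg_one_pow (show Odd 3 by decide)]
  · intro a b c d
    rw [hperm ![a, b, c, d] 0 1 (by decide)]
    congr 2
    ext i
    fin_cases i <;> rfl
  · intro a b c d
    rw [hperm ![a, b, c, d] 2 3 (by decide)]
    congr 2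
    ext i
    fin_cases i <;> rfl

/-- The Weyl tensor in an orthonormal frame with electric part `E` and magnetic part `B`. -/
def ofElectricMagnetic (E B : Matrix (Fin 3) (Fin 3) ℝ) (a b c d : Fin 4) : ℝ :=
  pairSign a b * pairSign c d *
    !![E, B; B, -E] (pairIndex a b).1 (pairIndex c d).1 (pairIndex a b).2 (pairIndex c d).2

/-- The symmetric traceless matrix with the given five components. -/
def symTraceless (x : Fin 5 → ℝ) : Matrix (Fin 3) (Fin 3) ℝ :=
  !![x 0, x 1, x 2; x 1, x 3, x 4; x 2, x 4, -x 0 - x 3]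

lemma neg_symTraceless (x : Fin 5 → ℝ) : -symTraceless x = symTraceless (-x) := by
  ext i j
  fin_cases i <;> fin_cases j <;> simp [symTraceless, add_comm]

lemma IsFrameWeyl.exists_eq {w : Tensor 4} (hw : IsFrameWeyl w) : ∃ e b : Fin 5 → ℝ,
    ∀ a a' c c', w ![a, a', c, c']
      = ofElectricMagnetic (symTraceless e) (symTraceless b) a a' c c' := by
  obtain ⟨M, hM⟩ : ∃ M : Fin 2 × Fin 3 → Fin 2 × Fin 3 → ℝ, ∀ x y,
      w ![(pairBasis x).1, (pairBasis x).2, (pairBasis y).1, (pairBasis y).2] = M x y :=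
    ⟨_, fun _ _ => rfl⟩
  have hw' : ∀ a b c d, w ![a, b, c, d]
      = pairSign a b * pairSign c d * M (pairIndex a b) (pairIndex c d) := by
    intro a b c d
    rw [eq_pairSign_mul hw.antisymm_left hw.antisymm_right, hM]
  have key : ∃ e b : Fin 5 → ℝ, ∀ x y : Fin 2 × Fin 3, M x y
      = !![symTraceless e, symTraceless b; symTraceless b, -symTraceless e] x.1 y.1 x.2 y.2 := by
    have hs : ∀ x y, M x y = M y x := fun x y => by rw [← hM, hw.pair_symm, hM]
    refine ⟨![M (0, 0) (0, 0), M (0, 0) (0, 1), M (0, 0) (0, 2), M (0, 1) (0, 1), M (0, 1) (0, 2)],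
      ![M (0, 0) (1, 0), M (0, 0) (1, 1), M (0, 0) (1, 2), M (0, 1) (1, 1), M (0, 1) (1, 2)], ?_⟩
    -- The cyclic identity gives tr B = 0 and the (0,0) trace gives tr E = 0. The (0,i) traces make
    -- B symmetric, and the spatial traces force the last block to be -E.
    have hc := hw.cyclic 0 1 2 3
    have ht := hw.traceless
    have t00 := ht 0 0
    have t01 := ht 0 1
    have t02 := ht 0 2
    have t03 := ht 0 3
    have t11 := ht 1 1
    have t12 := ht 1 2
    have t13 := ht 1 3
    have t22 := ht 2 2
    have t23 := ht 2 3
    have t33 := ht 3 3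
    simp [hw', Fin.sum_univ_four, pairSign, pairIndex, sgn] at hc t00 t01 t02 t03 t11 t12
    simp [hw', Fin.sum_univ_four, pairSign, pairIndex, sgn] at t13 t22 t23 t33
    rintro ⟨x1, x2⟩ ⟨y1, y2⟩
    fin_cases x1 <;> fin_cases x2 <;> fin_cases y1 <;> fin_cases y2 <;>
      simp [symTraceless] <;>
      linarith [hs (0, 0) (0, 1), hs (0, 0) (0, 2), hs (0, 1) (0, 2), hs (1, 0) (1, 1),
        hs (1, 0) (1, 2), hs (1, 1) (1, 2), hs (0, 0) (1, 0), hs (0, 0) (1, 1), hs (0, 0) (1, 2),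
        hs (0, 1) (1, 0), hs (0, 1) (1, 1), hs (0, 1) (1, 2), hs (0, 2) (1, 0), hs (0, 2) (1, 1),
        hs (0, 2) (1, 2)]
  obtain ⟨e, b, h⟩ := key
  refine ⟨e, b, fun a a' c c' => ?_⟩
  rw [hw', h, ofElectricMagnetic]

lemma frameDual_eq {w : Tensor 4} {e b : Fin 5 → ℝ}
    (h : ∀ a a' c c', w ![a, a', c, c']
      = ofElectricMagnetic (symTraceless e) (symTraceless b) a a' c c') (a a' c c' : Fin 4) :
    frameDual w a a' c c'
      = ofElectricMagnetic (symTraceless b) (symTraceless (-e)) a a' c c' := by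
  simp only [frameDual, h, leviCivita_eq, ofElectricMagnetic, ← neg_symTraceless]
  generalize pairIndex c c' = y
  generalize pairIndex a a' = x
  obtain ⟨x1, x2⟩ := x
  obtain ⟨y1, y2⟩ := y
  fin_cases x1 <;> fin_cases x2 <;> fin_cases y1 <;>
    simp [Fin.sum_univ_four, pairSign, pairIndex, sgn] <;> ring

/-! ### Components of the Bel–Robinson tensor and their quadratic relations -/

section ElectricMagnetic

variable (e b : Fin 5 → ℝ)

/-- The Bel-Robinson tensor in an orthonormal frame as a function of the components of the electric
and magnetic parts. -/
def electricMagneticBelRobinson (a a' c c' : Fin 4) : ℝ :=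
  (1 / 4) * (frameSquare (ofElectricMagnetic (symTraceless e) (symTraceless b)) a a' c c'
    + frameSquare (ofElectricMagnetic (symTraceless b) (symTraceless (-e))) a a' c c')

lemma belRobinson_time : electricMagneticBelRobinson e b 0 0 0 0
    = (1 / 4) * (symTraceless e ^ 2 + symTraceless b ^ 2).trace := by
  simp [electricMagneticBelRobinson, frameSquare, Fin.sum_univ_four, ofElectricMagnetic,
    pairSign, pairIndex, symTraceless, sgn, pow_two, Matrix.trace, Fin.sum_univ_three]
  ring

/-- The super-Poynting vector of the electric part `E` and the magnetic part `B`. -/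
def superPoynting (E B : Matrix (Fin 3) (Fin 3) ℝ) (i : Fin 3) : ℝ :=
  (1 / 2) * ∑ k, crossProduct (E.col k) (B.col k) i

lemma belRobinson_time_time_time_space (i : Fin 3) :
    electricMagneticBelRobinson e b 0 0 0 i.succ
      = superPoynting (symTraceless e) (symTraceless b) i := by
  fin_cases i <;>
    simp [electricMagneticBelRobinson, frameSquare, Fin.sum_univ_four, ofElectricMagnetic,
      pairSign, pairIndex, symTraceless, sgn, superPoynting, Fin.sum_univ_three,
      cross_apply] <;> ring

lemma belRobinson_time_time_space_space (k l : Fin 3) :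
    electricMagneticBelRobinson e b 0 0 k.succ l.succ
      = (1 / 4) * ((if k = l then (symTraceless e ^ 2 + symTraceless b ^ 2).trace else 0)
        - 2 * (symTraceless e ^ 2 + symTraceless b ^ 2) k l) := by
  fin_cases k <;> fin_cases l <;>
    simp [electricMagneticBelRobinson, frameSquare, Fin.sum_univ_four, ofElectricMagnetic,
      pairSign, pairIndex, symTraceless, sgn, pow_two, Matrix.trace, Fin.sum_univ_three] <;> ring

lemma belRobinson_time_space_space_space (i k l : Fin 3) :
    electricMagneticBelRobinson e b 0 i.succ k.succ l.succ
      = (if k = l then superPoynting (symTraceless e) (symTraceless b) i else 0)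
        - (1 / 2) * (crossProduct ((symTraceless e).col k) ((symTraceless b).col l) i
          + crossProduct ((symTraceless e).col l) ((symTraceless b).col k) i) := by
  fin_cases i <;> fin_cases k <;> fin_cases l <;>
    simp [electricMagneticBelRobinson, frameSquare, Fin.sum_univ_four, ofElectricMagnetic,
      pairSign, pairIndex, symTraceless, sgn, superPoynting, Fin.sum_univ_three,
      cross_apply] <;> ring

set_option maxHeartbeats 1000000 in
lemma belRobinson_space (i j k l : Fin 3) :
    electricMagneticBelRobinson e b i.succ j.succ k.succ l.succ
      = (1 / 4) * ((if i = j ∧ k = l then (symTraceless e ^ 2 + symTraceless b ^ 2).trace else 0)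
        - 2 * (if i = j then (symTraceless e ^ 2 + symTraceless b ^ 2) k l else 0)
        - 2 * (if k = l then (symTraceless e ^ 2 + symTraceless b ^ 2) i j else 0)
        + 2 * (symTraceless e i k * symTraceless e j l + symTraceless e i l * symTraceless e j k)
        + 2 * (symTraceless b i k * symTraceless b j l
          + symTraceless b i l * symTraceless b j k)) := by
  fin_cases i <;> fin_cases j <;> fin_cases k <;> fin_cases l <;>
    simp [electricMagneticBelRobinson, frameSquare, Fin.sum_univ_four, ofElectricMagnetic,
      pairSign, pairIndex, symTraceless, sgn, pow_two, Matrix.trace, Fin.sum_univ_three] <;> ring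

lemma stressFlux_identity :
    ∑ i : Fin 3, ∑ j : Fin 3, ∑ k : Fin 3,
        electricMagneticBelRobinson e b 0 i.succ j.succ k.succ ^ 2
      - ∑ i : Fin 3, electricMagneticBelRobinson e b 0 0 0 i.succ ^ 2
      = 3 * (electricMagneticBelRobinson e b 0 0 0 0 ^ 2
        - ∑ i : Fin 3, ∑ j : Fin 3, electricMagneticBelRobinson e b 0 0 i.succ j.succ ^ 2) := by
  simp only [belRobinson_time, belRobinson_time_time_time_space, belRobinson_time_time_space_space,
    belRobinson_time_space_space_space]
  simp [superPoynting, Fin.sum_univ_three, cross_apply, symTraceless, pow_two, Matrix.trace]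
  ring

lemma stressStress_identity :
    ∑ h : Fin 3, ∑ i : Fin 3, ∑ j : Fin 3, ∑ k : Fin 3,
        electricMagneticBelRobinson e b h.succ i.succ j.succ k.succ ^ 2
      = 3 * electricMagneticBelRobinson e b 0 0 0 0 ^ 2
        - 8 * ∑ i : Fin 3, electricMagneticBelRobinson e b 0 0 0 i.succ ^ 2
        + 6 * ∑ i : Fin 3, ∑ j : Fin 3, electricMagneticBelRobinson e b 0 0 i.succ j.succ ^ 2 := by
  simp only [belRobinson_time, belRobinson_time_time_time_space, belRobinson_time_time_space_space,
    belRobinson_space]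
  simp [superPoynting, Fin.sum_univ_three, cross_apply, symTraceless, pow_two, Matrix.trace]
  ring

/-- This is tr X⁴ = (tr X²)² / 2, the trace of X times the Cayley–Hamilton relation X³ = (tr X² / 2)
X + det X for traceless X. -/
lemma sum_sq_symTraceless_mul (x : Fin 5 → ℝ) : ∑ i, ∑ j, (symTraceless x ^ 2) i j ^ 2
    = (1 / 2) * (symTraceless x ^ 2).trace ^ 2 := by
  simp [Fin.sum_univ_three, symTraceless, pow_two, Matrix.trace]
  ring

lemma trace_sq_symTraceless_nonneg (x : Fin 5 → ℝ) : 0 ≤ (symTraceless x ^ 2).trace := by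
  simp [Fin.sum_univ_three, symTraceless, pow_two, Matrix.trace]
  nlinarith [sq_nonneg (x 0), sq_nonneg (x 1), sq_nonneg (x 2), sq_nonneg (x 3),
    sq_nonneg (x 4), sq_nonneg (x 0 + x 3)]

lemma superStress_le :
    ∑ i : Fin 3, ∑ j : Fin 3, electricMagneticBelRobinson e b 0 0 i.succ j.succ ^ 2
      ≤ electricMagneticBelRobinson e b 0 0 0 0 ^ 2 := by
  have he := sum_sq_symTraceless_mul e
  have hb := sum_sq_symTraceless_mul b
  have hpe := trace_sq_symTraceless_nonneg e
  have hpb := trace_sq_symTraceless_nonneg b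
  simp only [belRobinson_time, belRobinson_time_time_space_space, Matrix.add_apply,
    Matrix.trace_add]
  have hte : (symTraceless e ^ 2).trace = ∑ i, (symTraceless e ^ 2) i i := rfl
  have htb : (symTraceless b ^ 2).trace = ∑ i, (symTraceless b ^ 2) i i := rfl
  set A := symTraceless e ^ 2
  set B := symTraceless b ^ 2
  have hcs := Finset.sum_mul_sq_le_sq_mul_sq (Finset.univ : Finset (Fin 3 × Fin 3))
    (fun x => A x.1 x.2) (fun x => B x.1 x.2)
  simp only [Fintype.sum_prod_type] at hcs
  rw [he, hb] at hcs
  -- Cauchy–Schwarz bounds the square of A·B by |A|²|B|² = (tr A tr B / 2)².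
  have h2 : ∑ i, ∑ j, A i j * B i j ≤ (1 / 2) * (A.trace * B.trace) :=
    le_of_abs_le (abs_le_of_sq_le_sq (by linarith) (by positivity))
  have h3 : ∑ i, ∑ j, (1 / 4 * ((if i = j then A.trace + B.trace else 0) - 2 * (A i j + B i j))) ^ 2
      = (1 / 16) * (4 * ∑ i, ∑ j, A i j ^ 2 + 8 * ∑ i, ∑ j, A i j * B i j
        + 4 * ∑ i, ∑ j, B i j ^ 2 - (A.trace + B.trace) ^ 2) := by
    rw [hte, htb]
    simp [Fin.sum_univ_three]
    ring
  rw [h3, he, hb]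
  linarith

end ElectricMagnetic

theorem superEnergyConstraints_of_isWeylTensor {g : Matrix (Fin 4) (Fin 4) ℝ} {W : Tensor 4}
    {u : Fin 4 → ℝ} (hg : IsLorentzian g) (hW : IsWeylTensor g W) (hu : IsObserver g u) :
    SuperEnergyConstraints g (belRobinson g W) u := by
  obtain ⟨P, hP⟩ := exists_frame hg hu
  obtain ⟨e, b, h⟩ := (hW.pull hP).exists_eq
  have hT : ∀ a a' c c', pull P (belRobinson g W) ![a, a', c, c']
      = electricMagneticBelRobinson e b a a' c c' := by
    intro a a' c c'
    rw [pull_belRobinson hP, frameBelRobinson, electricMagneticBelRobinson]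
    simp only [h, frameSquare, frameDual_eq h]
  have hflux := stressFlux_identity e b
  have hstress := stressStress_identity e b
  have hle := superStress_le e b
  have hτ : 0 ≤ tau (belRobinson g W) u := by
    rw [tau_eq hP, hT, belRobinson_time, Matrix.trace_add]
    have := trace_sq_symTraceless_nonneg e
    have := trace_sq_symTraceless_nonneg b
    positivity
  have hT4 := TPerp_sq hP (belRobinson g W)
  simp only [← hT, ← tau_eq hP, ← qPerp_sq hP, ← tPerp_sq hP, ← QPerp_sq hP] at hflux hle
  simp only [← hT, ← tau_eq hP, ← qPerp_sq hP, ← tPerp_sq hP, ← TPerp_sq hP] at hstress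
  refine ⟨hflux, by linarith, ?_⟩
  rw [sub_nonneg]
  refine le_of_sq_le_sq ?_ (by positivity)
  -- Dropping -8|q_⊥|² and using |t_⊥|² ≤ τ² leaves |T_⊥|² ≤ 3τ² + 6τ² = (3τ)².
  nlinarith [sq_nonneg (modulus g (qPerp g (belRobinson g W) u))]

/-! ### Calculus of partial derivatives -/

section PartialDeriv

variable {f h : (Fin 4 → ℝ) → ℝ} {x : Fin 4 → ℝ}

lemma partialDeriv_congr (i : Fin 4) (hfh : f =ᶠ[nhds x] h) :
    partialDeriv i f x = partialDeriv i h x := by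
  rw [partialDeriv, partialDeriv, hfh.fderiv_eq]

lemma partialDeriv_add (i : Fin 4) (hf : DifferentiableAt ℝ f x) (hh : DifferentiableAt ℝ h x) :
    partialDeriv i (fun y => f y + h y) x = partialDeriv i f x + partialDeriv i h x := by
  simp [partialDeriv, fderiv_fun_add hf hh]

lemma partialDeriv_sub (i : Fin 4) (hf : DifferentiableAt ℝ f x) (hh : DifferentiableAt ℝ h x) :
    partialDeriv i (fun y => f y - h y) x = partialDeriv i f x - partialDeriv i h x := by
  simp [partialDeriv, fderiv_fun_sub hf hh]

lemma partialDeriv_const_mul (i : Fin 4) (c : ℝ) (hf : DifferentiableAt ℝ f x) :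
    partialDeriv i (fun y => c * f y) x = c * partialDeriv i f x := by
  simp [partialDeriv, fderiv_const_mul hf]

lemma partialDeriv_mul (i : Fin 4) (hf : DifferentiableAt ℝ f x) (hh : DifferentiableAt ℝ h x) :
    partialDeriv i (fun y => f y * h y) x
      = partialDeriv i f x * h x + f x * partialDeriv i h x := by
  simp [partialDeriv, fderiv_fun_mul hf hh]
  ring

lemma partialDeriv_sum (i : Fin 4) {F : Fin 4 → (Fin 4 → ℝ) → ℝ}
    (hF : ∀ e, DifferentiableAt ℝ (F e) x) :
    partialDeriv i (fun y => ∑ e, F e y) x = ∑ e, partialDeriv i (F e) x := by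
  simp [partialDeriv, fderiv_fun_sum (fun e _ => hF e)]

lemma differentiableAt_fderiv (hf : ContDiffAt ℝ 2 f x) : DifferentiableAt ℝ (fderiv ℝ f) x :=
  (hf.fderiv_right (m := 1) (by norm_num)).differentiableAt one_ne_zero

lemma differentiableAt_partialDeriv (i : Fin 4) (hf : ContDiffAt ℝ 2 f x) :
    DifferentiableAt ℝ (partialDeriv i f) x :=
  (differentiableAt_fderiv hf).clm_apply (differentiableAt_const _)

lemma partialDeriv_comm (i j : Fin 4) (hf : ContDiffAt ℝ 2 f x) :
    partialDeriv i (partialDeriv j f) x = partialDeriv j (partialDeriv i f) x := by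
  have key : ∀ i j, partialDeriv i (partialDeriv j f) x
      = fderiv ℝ (fderiv ℝ f) x (Pi.single i 1) (Pi.single j 1) := by
    intro i j
    have : partialDeriv j f = fun y => fderiv ℝ f y (Pi.single j 1) := rfl
    rw [this, partialDeriv, fderiv_clm_apply (differentiableAt_fderiv hf)
      (differentiableAt_const _)]
    simp
  rw [key, key]
  exact (hf.isSymmSndFDerivAt (by simp)).eq _ _

end PartialDeriv

lemma IsLorentzian.isUnit_det {g : Matrix (Fin 4) (Fin 4) ℝ} (hg : IsLorentzian g) :
    IsUnit g.det := by
  obtain ⟨-, P, -, h⟩ := hg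
  have := congrArg Matrix.det h
  simp only [Matrix.det_mul, Matrix.det_transpose, Matrix.det_diagonal] at this
  rw [isUnit_iff_ne_zero]
  intro h0
  rw [h0] at this
  simp [Fin.prod_univ_four] at this

lemma differentiableAt_det {M : (Fin 4 → ℝ) → Matrix (Fin 4) (Fin 4) ℝ} {x : Fin 4 → ℝ}
    (hM : ∀ a b, DifferentiableAt ℝ (fun y => M y a b) x) :
    DifferentiableAt ℝ (fun y => (M y).det) x := by
  simp only [Matrix.det_apply']
  refine DifferentiableAt.fun_sum fun σ _ => DifferentiableAt.const_mul ?_ _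
  simp only [Fin.prod_univ_four]
  exact (((hM _ _).mul (hM _ _)).mul (hM _ _)).mul (hM _ _)

/-- By Cramer's rule an entry of the inverse is a determinant, with one row replaced by a unit
vector, divided by det M. -/
lemma differentiableAt_inv_apply {M : (Fin 4 → ℝ) → Matrix (Fin 4) (Fin 4) ℝ} {x : Fin 4 → ℝ}
    (hM : ∀ a b, DifferentiableAt ℝ (fun y => M y a b) x) (hx : (M x).det ≠ 0) (a b : Fin 4) :
    DifferentiableAt ℝ (fun y => (M y)⁻¹ a b) x := by
  simp only [Matrix.inv_def, Matrix.smul_apply, Matrix.adjugate_apply, smul_eq_mul,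
    Ring.inverse_eq_inv']
  refine ((differentiableAt_det hM).inv hx).mul (differentiableAt_det fun i j => ?_)
  by_cases h : i = b
  · simp [Matrix.updateRow_apply, h]
  · simpa [Matrix.updateRow_apply, h] using hM i j

/-- The Christoffel symbols of the first kind. -/
def lowerChristoffel (g : (Fin 4 → ℝ) → Matrix (Fin 4) (Fin 4) ℝ) (a b c : Fin 4)
    (x : Fin 4 → ℝ) : ℝ :=
  (1 / 2) * (partialDeriv b (fun y => g y a c) x + partialDeriv c (fun y => g y a b) x
    - partialDeriv a (fun y => g y b c) x)

/-! ### Symmetries of the Riemann and Weyl tensors of a C² metric -/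

section Metric

variable {g : (Fin 4 → ℝ) → Matrix (Fin 4) (Fin 4) ℝ} {U : Set (Fin 4 → ℝ)} {x : Fin 4 → ℝ}

namespace IsSpacetimeMetricOn

lemma contDiffAt (hg : IsSpacetimeMetricOn g U) (hx : x ∈ U) (a b : Fin 4) :
    ContDiffAt ℝ 2 (fun y => g y a b) x :=
  (hg.contDiffOn a b).contDiffAt (hg.isOpen.mem_nhds hx)

lemma differentiableAt (hg : IsSpacetimeMetricOn g U) (hx : x ∈ U) (a b : Fin 4) :
    DifferentiableAt ℝ (fun y => g y a b) x :=
  (hg.contDiffAt hx a b).differentiableAt two_ne_zero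

lemma symm_apply (hg : IsSpacetimeMetricOn g U) (hx : x ∈ U) (a b : Fin 4) : g x a b = g x b a :=
  (hg.lorentzian x hx).1.apply b a

lemma partialDeriv_symm (hg : IsSpacetimeMetricOn g U) (hx : x ∈ U) (i a b : Fin 4) :
    partialDeriv i (fun y => g y a b) x = partialDeriv i (fun y => g y b a) x :=
  partialDeriv_congr i (Filter.eventuallyEq_of_mem (hg.isOpen.mem_nhds hx)
    fun _ hy => hg.symm_apply hy a b)

lemma partialDeriv_partialDeriv_symm (hg : IsSpacetimeMetricOn g U) (hx : x ∈ U)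
    (i j a b : Fin 4) : partialDeriv i (partialDeriv j fun y => g y a b) x
      = partialDeriv i (partialDeriv j fun y => g y b a) x :=
  partialDeriv_congr i (Filter.eventuallyEq_of_mem (hg.isOpen.mem_nhds hx)
    fun _ hy => hg.partialDeriv_symm hy j a b)

lemma christoffel_eq (g : (Fin 4 → ℝ) → Matrix (Fin 4) (Fin 4) ℝ) (x : Fin 4 → ℝ)
    (a b c : Fin 4) : christoffel g a b c x = ∑ d, (g x)⁻¹ a d * lowerChristoffel g d b c x := by
  rw [christoffel, Finset.mul_sum]
  exact Finset.sum_congr rfl fun d _ => by rw [lowerChristoffel]; ring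

lemma sum_mul_christoffel (hg : IsSpacetimeMetricOn g U) (hx : x ∈ U) (a b c : Fin 4) :
    ∑ e, g x a e * christoffel g e b c x = lowerChristoffel g a b c x := by
  have h : g x * (g x)⁻¹ = 1 := Matrix.mul_nonsing_inv _ (hg.lorentzian x hx).isUnit_det
  have : ∀ d, ∑ e, g x a e * (g x)⁻¹ e d = if a = d then 1 else 0 := by
    intro d
    rw [← Matrix.mul_apply, h, Matrix.one_apply]
  simp only [christoffel_eq, Finset.mul_sum]
  rw [Finset.sum_comm]
  simp only [← mul_assoc, ← Finset.sum_mul, this]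
  simp

lemma differentiableAt_lowerChristoffel (hg : IsSpacetimeMetricOn g U) (hx : x ∈ U)
    (a b c : Fin 4) : DifferentiableAt ℝ (lowerChristoffel g a b c) x :=
  (((differentiableAt_partialDeriv b (hg.contDiffAt hx a c)).add
    (differentiableAt_partialDeriv c (hg.contDiffAt hx a b))).sub
    (differentiableAt_partialDeriv a (hg.contDiffAt hx b c))).const_mul _

lemma differentiableAt_christoffel (hg : IsSpacetimeMetricOn g U) (hx : x ∈ U) (a b c : Fin 4) :
    DifferentiableAt ℝ (christoffel g a b c) x := by
  have : christoffel g a b c = fun y => ∑ d, (g y)⁻¹ a d * lowerChristoffel g d b c y :=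
    funext fun y => christoffel_eq g y a b c
  rw [this]
  exact DifferentiableAt.fun_sum fun d _ =>
    (differentiableAt_inv_apply (hg.differentiableAt hx)
      (hg.lorentzian x hx).isUnit_det.ne_zero a d).mul
    (hg.differentiableAt_lowerChristoffel hx d b c)

lemma partialDeriv_lowerChristoffel (hg : IsSpacetimeMetricOn g U) (hx : x ∈ U) (i a b c : Fin 4) :
    partialDeriv i (lowerChristoffel g a b c) x
      = (1 / 2) * (partialDeriv i (partialDeriv b fun y => g y a c) x
        + partialDeriv i (partialDeriv c fun y => g y a b) x
        - partialDeriv i (partialDeriv a fun y => g y b c) x) := by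
  have h1 := differentiableAt_partialDeriv b (hg.contDiffAt hx a c)
  have h2 := differentiableAt_partialDeriv c (hg.contDiffAt hx a b)
  have h3 := differentiableAt_partialDeriv a (hg.contDiffAt hx b c)
  rw [← partialDeriv_add i h1 h2, ← partialDeriv_sub i (h1.fun_add h2) h3,
    ← partialDeriv_const_mul i _ ((h1.fun_add h2).fun_sub h3)]
  rfl

lemma sum_mul_partialDeriv_christoffel (hg : IsSpacetimeMetricOn g U) (hx : x ∈ U)
    (i a b c : Fin 4) :
    ∑ e, g x a e * partialDeriv i (christoffel g e b c) x
      = partialDeriv i (lowerChristoffel g a b c) x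
        - ∑ e, partialDeriv i (fun y => g y a e) x * christoffel g e b c x := by
  have h : partialDeriv i (lowerChristoffel g a b c) x
      = partialDeriv i (fun y => ∑ e, g y a e * christoffel g e b c y) x :=
    partialDeriv_congr i (Filter.eventuallyEq_of_mem (hg.isOpen.mem_nhds hx)
      fun _ hy => (hg.sum_mul_christoffel hy a b c).symm)
  rw [h, partialDeriv_sum i fun e =>
    (hg.differentiableAt hx a e).fun_mul (hg.differentiableAt_christoffel hx e b c)]
  simp only [partialDeriv_mul i (hg.differentiableAt hx a _)
    (hg.differentiableAt_christoffel hx _ b c), Finset.sum_add_distrib]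
  ring

lemma partialDeriv_eq_lowerChristoffel_add (hg : IsSpacetimeMetricOn g U) (hx : x ∈ U)
    (i a b : Fin 4) : partialDeriv i (fun y => g y a b) x
      = lowerChristoffel g a i b x + lowerChristoffel g b i a x := by
  rw [lowerChristoffel, lowerChristoffel, hg.partialDeriv_symm hx i b a,
    hg.partialDeriv_symm hx b a i, hg.partialDeriv_symm hx a b i]
  ring

/-- Lowering the index inside ∂Γ produces a term in ∂g. Writing ∂_i g_{ab} = Γ_{a,ib} + Γ_{b,ia},
one half of it cancels the original ΓΓ terms, and the other half gives the products displayed. -/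
lemma riemann_eq (hg : IsSpacetimeMetricOn g U) (hx : x ∈ U) (a b c d : Fin 4) :
    riemann g a b c d x = (1 / 2) * (partialDeriv c (partialDeriv b fun y => g y a d) x
        - partialDeriv c (partialDeriv a fun y => g y d b) x
        - partialDeriv d (partialDeriv b fun y => g y a c) x
        + partialDeriv d (partialDeriv a fun y => g y c b) x)
      - ∑ e, lowerChristoffel g e c a x * christoffel g e d b x
      + ∑ e, lowerChristoffel g e d a x * christoffel g e c b x := by
  have h1 : riemann g a b c d x = ∑ e, g x a e * partialDeriv c (christoffel g e d b) x
      - ∑ e, g x a e * partialDeriv d (christoffel g e c b) x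
      + ∑ f, (∑ e, g x a e * christoffel g e c f x) * christoffel g f d b x
      - ∑ f, (∑ e, g x a e * christoffel g e d f x) * christoffel g f c b x := by
    simp only [riemann, riemannUp, mul_add, mul_sub, Finset.sum_add_distrib,
      Finset.sum_sub_distrib, Finset.mul_sum, Finset.sum_mul, mul_assoc]
    rw [Finset.sum_comm, Finset.sum_comm (f := fun e f =>
      g x a e * (christoffel g e d f x * christoffel g f c b x))]
    ring
  rw [h1]
  simp only [hg.sum_mul_partialDeriv_christoffel hx, hg.sum_mul_christoffel hx,
    hg.partialDeriv_eq_lowerChristoffel_add hx _ a, hg.partialDeriv_lowerChristoffel hx,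
    add_mul, Finset.sum_add_distrib,
    partialDeriv_comm d c (hg.contDiffAt hx a b)]
  ring

/-- Both sides are the `g`-product of two Christoffel vectors, so this is the symmetry of `g`. -/
lemma sum_lowerChristoffel_mul_symm (hg : IsSpacetimeMetricOn g U) (hx : x ∈ U)
    (a b c d : Fin 4) : ∑ e, lowerChristoffel g e a b x * christoffel g e c d x
      = ∑ e, lowerChristoffel g e c d x * christoffel g e a b x := by
  simp only [← hg.sum_mul_christoffel hx, Finset.sum_mul]
  rw [Finset.sum_comm]
  refine Finset.sum_congr rfl fun e _ => Finset.sum_congr rfl fun f _ => ?_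
  rw [hg.symm_apply hx]
  ring

lemma lowerChristoffel_symm (hg : IsSpacetimeMetricOn g U) (hx : x ∈ U) (a b c : Fin 4) :
    lowerChristoffel g a b c x = lowerChristoffel g a c b x := by
  rw [lowerChristoffel, lowerChristoffel, hg.partialDeriv_symm hx a b c]
  ring

lemma christoffel_symm (hg : IsSpacetimeMetricOn g U) (hx : x ∈ U) (a b c : Fin 4) :
    christoffel g a b c x = christoffel g a c b x := by
  simp only [christoffel_eq, hg.lowerChristoffel_symm hx _ b c]

lemma riemann_antisymm_right (hg : IsSpacetimeMetricOn g U) (hx : x ∈ U) (a b c d : Fin 4) :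
    riemann g a b c d x = -riemann g a b d c x := by
  rw [hg.riemann_eq hx, hg.riemann_eq hx]
  ring

lemma riemann_pair_symm (hg : IsSpacetimeMetricOn g U) (hx : x ∈ U) (a b c d : Fin 4) :
    riemann g a b c d x = riemann g c d a b x := by
  rw [hg.riemann_eq hx, hg.riemann_eq hx]
  rw [partialDeriv_comm a d (hg.contDiffAt hx c b), partialDeriv_comm a c (hg.contDiffAt hx b d),
    partialDeriv_comm b d (hg.contDiffAt hx c a), partialDeriv_comm b c (hg.contDiffAt hx a d),
    hg.partialDeriv_partialDeriv_symm hx c a b d, hg.partialDeriv_partialDeriv_symm hx d b c a,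
    hg.sum_lowerChristoffel_mul_symm hx d a c b]
  simp only [hg.lowerChristoffel_symm hx _ a c, hg.christoffel_symm hx _ b d,
    hg.christoffel_symm hx _ a d, hg.lowerChristoffel_symm hx _ b c]
  ring

lemma riemann_antisymm_left (hg : IsSpacetimeMetricOn g U) (hx : x ∈ U) (a b c d : Fin 4) :
    riemann g a b c d x = -riemann g b a c d x := by
  rw [hg.riemann_pair_symm hx, hg.riemann_antisymm_right hx, hg.riemann_pair_symm hx]

lemma riemann_cyclic (hg : IsSpacetimeMetricOn g U) (hx : x ∈ U) (a b c d : Fin 4) :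
    riemann g a b c d x + riemann g a c d b x + riemann g a d b c x = 0 := by
  rw [hg.riemann_eq hx, hg.riemann_eq hx, hg.riemann_eq hx]
  rw [partialDeriv_comm c b (hg.contDiffAt hx a d), partialDeriv_comm d b (hg.contDiffAt hx a c),
    partialDeriv_comm d c (hg.contDiffAt hx a b),
    hg.partialDeriv_partialDeriv_symm hx c a d b, hg.partialDeriv_partialDeriv_symm hx d a c b,
    hg.partialDeriv_partialDeriv_symm hx b a d c]
  simp only [hg.christoffel_symm hx _ b d, hg.christoffel_symm hx _ b c,
    hg.christoffel_symm hx _ c d]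
  ring

lemma inv_symm (hg : IsSpacetimeMetricOn g U) (hx : x ∈ U) (a b : Fin 4) :
    (g x)⁻¹ a b = (g x)⁻¹ b a := by
  have : ((g x)⁻¹).transpose = (g x)⁻¹ := by
    rw [Matrix.transpose_nonsing_inv, (hg.lorentzian x hx).1.eq]
  exact (congrFun (congrFun this a) b).symm

lemma sum_inv_mul (hg : IsSpacetimeMetricOn g U) (hx : x ∈ U) (a b : Fin 4) :
    ∑ e, (g x)⁻¹ a e * g x e b = if a = b then 1 else 0 := by
  rw [← Matrix.mul_apply, Matrix.nonsing_inv_mul _ (hg.lorentzian x hx).isUnit_det,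
    Matrix.one_apply]

lemma ricci_eq (hg : IsSpacetimeMetricOn g U) (hx : x ∈ U) (b d : Fin 4) :
    ricci g b d x = ∑ a, ∑ c, (g x)⁻¹ a c * riemann g a b c d x := by
  simp only [riemann, Finset.mul_sum, ← mul_assoc]
  have : ∀ c e, ∑ a, (g x)⁻¹ a c * g x a e * riemannUp g e b c d x
      = if c = e then riemannUp g e b c d x else 0 := by
    intro c e
    rw [← Finset.sum_mul]
    have := hg.sum_inv_mul hx c e
    simp only [hg.inv_symm hx c] at this
    rw [this]
    simp
  rw [Finset.sum_comm]
  rw [ricci]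
  refine Finset.sum_congr rfl fun c _ => ?_
  rw [Finset.sum_comm]
  simp [this]

lemma ricci_symm (hg : IsSpacetimeMetricOn g U) (hx : x ∈ U) (b d : Fin 4) :
    ricci g b d x = ricci g d b x := by
  rw [hg.ricci_eq hx, hg.ricci_eq hx, Finset.sum_comm]
  refine Finset.sum_congr rfl fun a _ => Finset.sum_congr rfl fun c _ => ?_
  rw [hg.riemann_pair_symm hx, hg.inv_symm hx]

lemma isWeylTensor_weyl (hg : IsSpacetimeMetricOn g U) (hx : x ∈ U) :
    IsWeylTensor (g x) (weyl g x) where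
  antisymm_left a b c d := by
    simp [weyl]
    rw [hg.riemann_antisymm_left hx]
    ring
  antisymm_right a b c d := by
    simp [weyl]
    rw [hg.riemann_antisymm_right hx]
    ring
  pair_symm a b c d := by
    simp [weyl]
    rw [hg.riemann_pair_symm hx, hg.ricci_symm hx d b, hg.ricci_symm hx d a, hg.ricci_symm hx c b,
      hg.ricci_symm hx c a, hg.symm_apply hx c a, hg.symm_apply hx d b, hg.symm_apply hx c b,
      hg.symm_apply hx d a]
    ring
  cyclic a b c d := by
    simp [weyl]
    have := hg.riemann_cyclic hx a b c d
    rw [hg.ricci_symm hx d b, hg.ricci_symm hx c b, hg.ricci_symm hx d c,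
      hg.symm_apply hx d b, hg.symm_apply hx c b, hg.symm_apply hx d c]
    linear_combination this
  traceless b d := by
    have hR := hg.ricci_eq hx b d
    have h1 : ∀ c d, ∑ a, (g x)⁻¹ a c * g x a d = if c = d then 1 else 0 := by
      intro c d
      simpa only [hg.inv_symm hx c] using hg.sum_inv_mul hx c d
    -- Here dimension four enters: the Ricci coefficients add to 1 - 4/2 + 1/2 + 1/2 = 0 and those
    -- of the scalar curvature to -1/2 + 4/6 - 1/6 = 0.
    have hgg : ∑ a, ∑ c, (g x)⁻¹ a c * g x a c = 4 := by
      rw [Finset.sum_comm]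
      simp [h1]
    have hgl : ∀ X : Fin 4 → ℝ, ∑ a, ∑ c, (g x)⁻¹ a c * g x a d * X c = X d := by
      intro X
      rw [Finset.sum_comm]
      simp [← Finset.sum_mul, h1]
    have hgr : ∀ X : Fin 4 → ℝ, ∑ a, ∑ c, (g x)⁻¹ a c * g x b c * X a = X b := by
      intro X
      have : ∀ a, ∑ c, (g x)⁻¹ a c * g x b c = if a = b then 1 else 0 := by
        intro a
        simpa only [hg.symm_apply hx b] using hg.sum_inv_mul hx a b
      simp [← Finset.sum_mul, this]
    have hS : ∑ a, ∑ c, (g x)⁻¹ a c * ricci g a c x = scalarCurv g x := rfl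
    have expand : ∀ a c, (g x)⁻¹ a c * weyl g x ![a, b, c, d]
        = (g x)⁻¹ a c * riemann g a b c d x
          - (1 / 2) * ricci g b d x * ((g x)⁻¹ a c * g x a c)
          + (1 / 2) * ((g x)⁻¹ a c * g x a d * ricci g b c x)
          - (1 / 2) * g x b d * ((g x)⁻¹ a c * ricci g a c x)
          + (1 / 2) * ((g x)⁻¹ a c * g x b c * ricci g a d x)
          + (1 / 6) * scalarCurv g x * g x b d * ((g x)⁻¹ a c * g x a c)
          - (1 / 6) * scalarCurv g x * ((g x)⁻¹ a c * g x a d * g x b c) := by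
      intro a c
      simp [weyl]
      ring
    simp only [expand, Finset.sum_add_distrib, Finset.sum_sub_distrib, ← Finset.mul_sum, hgg,
      hgl, hgr, hS, ← hR]
    ring

end IsSpacetimeMetricOn

end Metric

end BelRobinson

end

/-- The constraints hold at every point of a spacetime for the Bel-Robinson tensor of its Weyl
tensor and, algebraically, for every tensor with the symmetries of a Weyl tensor. -/
theorem mainTheorem10 :
    (∀ (g : (Fin 4 → ℝ) → Matrix (Fin 4) (Fin 4) ℝ) (U : Set (Fin 4 → ℝ)),
      BelRobinson.IsSpacetimeMetricOn g U →
      ∀ x ∈ U, ∀ u : Fin 4 → ℝ, BelRobinson.IsObserver (g x) u →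
        BelRobinson.SuperEnergyConstraints (g x)
          (BelRobinson.belRobinson (g x) (BelRobinson.weyl g x)) u) ∧
    (∀ (g : Matrix (Fin 4) (Fin 4) ℝ) (W : BelRobinson.Tensor 4) (u : Fin 4 → ℝ),
      BelRobinson.IsLorentzian g → BelRobinson.IsWeylTensor g W → BelRobinson.IsObserver g u →
        BelRobinson.SuperEnergyConstraints g (BelRobinson.belRobinson g W) u) :=
  ⟨fun _ _ hg x hx _ hu => BelRobinson.superEnergyConstraints_of_isWeylTensor
      (hg.lorentzian x hx) (hg.isWeylTensor_weyl hx) hu,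
    fun _ _ _ hg hW hu => BelRobinson.superEnergyConstraints_of_isWeylTensor hg hW hu⟩
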